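/- Work in the Cayley–Klein model of the hyperbolic plane: its points are the interior points of the absolute conic $\mathcal N\colon x^2+y^2-1=0$, viewed in the real projective plane with homogeneous coordinates $[x_0,x_1,x_2]$, where $x=x_1/x_0$ and $y=x_2/x_0$. The interior $\operatorname{int} C$ of a regular conic $C$ is the set of points that lie on no (real) tangent of $C$. A horocycle is a regular conic $H$ that hyperosculates $\mathcal N$ at a point of $\mathcal N$ (that is, meets $\mathcal N$ there with intersection multiplicity four) and has all its other real points in the interior of $\mathcal N$; it is a Euclidean ellipse that hyperosculates $\mathcal N$ in a minor vertex. Its size, $\operatorname{size} H$, is the Euclidean length of its semi-major axis. A horocycle $H$ encloses a set $F$ if $F$ is contained in the closure of $\operatorname{int} H$. (1) Let $F$ be a non-empty compact subset of the hyperbolic plane that is enclosed by some horocycle of size $a<2^{-1/2}$. Then there exists a unique horocycle that encloses $F$ and has minimal size among all horocycles enclosing $F$. (2) Let $H_0\neq H_1$ be two horocycles of equal size $\operatorname{size} H_0=\operatorname{size} H_1=a<2^{-1/2}$ with $\operatorname{int} H_0\cap\operatorname{int} H_1\neq\emptyset$. Then there exists a horocycle $H$ with $\operatorname{size} H<a$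 and $\operatorname{int} H_0\cap\operatorname{int} H_1\subseteq\operatorname{int} H$. -/

import Mathlib

open scoped LinearAlgebra.Projectivization

noncomputable section

/-- The real projective plane, with homogeneous coordinates `[x₀, x₁, x₂]`. -/
abbrev ProjPlane : Type := ℙ ℝ (Fin 3 → ℝ)

/-- The lines of the real projective plane, with homogeneous line coordinates `[u₀, u₁, u₂]`. -/
abbrev ProjLine : Type := ℙ ℝ (Fin 3 → ℝ)

/-- The Euclidean plane, with Cartesian coordinates `(x, y)`. -/
abbrev Plane : Type := EuclideanSpace ℝ (Fin 2)

/-- The point `p` lies on the line `u`. -/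
def Incident (p : ProjPlane) (u : ProjLine) : Prop := u.rep ⬝ᵥ p.rep = 0

/-- The projective point `[1, x, y]` with Cartesian coordinates `(x, y)`. -/
def ofCartesian (p : Plane) : ProjPlane :=
  Projectivization.mk ℝ ![1, p 0, p 1] (fun h => one_ne_zero (congrFun h 0))

/-- The real symmetric matrices of dimension three by three. -/
def symmetricMatrices : Submodule ℝ (Matrix (Fin 3) (Fin 3) ℝ) where
  carrier := {C | C.IsSymm}
  zero_mem' := Matrix.isSymm_zero
  add_mem' := fun hC hD => Matrix.IsSymm.add hC hD
  smul_mem' := fun r _ hC => Matrix.IsSymm.smul hC r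

/-- A conic: a nonzero real symmetric matrix up to nonzero real multiples. -/
abbrev Conic : Type := ℙ ℝ symmetricMatrices

namespace Conic

/-- A matrix that represents the conic. The notions below do not depend on its scaling. -/
def matrix (C : Conic) : Matrix (Fin 3) (Fin 3) ℝ := (C.rep : Matrix (Fin 3) (Fin 3) ℝ)

/-- The quadratic form `vᵗ C v`. -/
def form (C : Conic) (v : Fin 3 → ℝ) : ℝ := v ⬝ᵥ C.matrix.mulVec v

/-- The conic is represented by an invertible matrix. -/
def IsRegular (C : Conic) : Prop := C.matrix.det ≠ 0

/-- The real points of the conic in the projective plane. -/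
def points (C : Conic) : Set ProjPlane := {p | C.form p.rep = 0}

/-- The line `u` is a tangent of the (regular) conic `C`: `uᵗ C⁻¹ u = 0`. -/
def IsTangent (C : Conic) (u : ProjLine) : Prop := u.rep ⬝ᵥ C.matrix⁻¹.mulVec u.rep = 0

/-- The interior of a (regular) conic: the points that lie on no tangent. -/
def interior (C : Conic) : Set ProjPlane := {p | ∀ u, C.IsTangent u → ¬ Incident p u}

/-- The closure of the interior, in Cartesian coordinates and the Euclidean topology. -/
def closedInterior (C : Conic) : Set Plane := closure {p | ofCartesian p ∈ C.interior}

/-- The set `F` is enclosed by the conic. Points of `F` may lie on the conic. -/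
def Encloses (C : Conic) (F : Set Plane) : Prop := F ⊆ C.closedInterior

/-- Half the length of a longest chord in the Euclidean plane.
For an ellipse this is the length of the semi-major axis. -/
def size (C : Conic) : ℝ := Metric.diam {p : Plane | ofCartesian p ∈ C.points} / 2

end Conic

/-- The absolute conic `x² + y² - 1 = 0` of the Cayley-Klein model. -/
def absoluteConic : Conic :=
  Projectivization.mk ℝ
    ⟨Matrix.diagonal ![-1, 1, 1], Matrix.isSymm_diagonal _⟩
    (fun h => one_ne_zero (congrFun (congrFun (congrArg Subtype.val h) 1) 1))

/-- The points of the hyperbolic plane, in Cartesian coordinates. -/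
def hyperbolicPlane : Set Plane := {p | ofCartesian p ∈ absoluteConic.interior}

/-- The ideal point with Cartesian coordinates `(cos θ, sin θ)`. -/
def idealPoint (θ : ℝ) : ProjPlane := ofCartesian !₂[Real.cos θ, Real.sin θ]

/-- The conic `C` hyperosculates the absolute conic at the ideal point `(cos θ, sin θ)`, that is,
its intersection multiplicity with the absolute conic there is at least four: the equation of `C`,
restricted to the absolute conic, vanishes there together with its first three derivatives. -/
def HyperosculatesAbsoluteAt (C : Conic) (θ : ℝ) : Prop :=
  ∀ k < 4, iteratedDeriv k (fun t : ℝ => C.form ![1, Real.cos t, Real.sin t]) θ = 0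

/-- A horocycle: a regular conic that hyperosculates the absolute conic at an ideal point and
has all its other points in the interior of the absolute conic. -/
def IsHorocycle (H : Conic) : Prop :=
  H.IsRegular ∧ ∃ θ : ℝ, HyperosculatesAbsoluteAt H θ ∧
    ∀ p ∈ H.points, p ≠ idealPoint θ → p ∈ absoluteConic.interior

/-- The conic `H` is a horocycle that encloses `F` and has minimal size among all of these. -/
def IsMinimalEnclosingHorocycle (F : Set Plane) (H : Conic) : Prop :=
  IsHorocycle H ∧ H.Encloses F ∧ ∀ H' : Conic, IsHorocycle H' → H'.Encloses F → H.size ≤ H'.size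

end

/-! Fourfold contact with the unit circle at u = (cos θ, sin θ) forces the equation x² + y² - 1 + c
(1 - ⟨p,u⟩)² = 0 up to scale, and the horocycles are exactly the cases c > 0 (`isHorocycle_iff`).
The semi-major axis is (1 + c)^(-1/2) (`size_horoConic`), so small size means large c, and size
below 2^(-1/2) means c > 1.

For p in the open disc, enclosure reads 1 - ⟨p,u⟩ ≤ k √(1 - |p|²) with k = c^(-1/2), which is affine
in u (`horoFun_le_zero_iff`). Averaging this over two distinct directions replaces u by a midpoint
of length m < 1. When k < 1, renormalising that midpoint to length one leaves room to decrease k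
(`exists_smaller_horocycle`).

Part (2) is this averaging together with a strictness adjustment. In part (1), uniqueness follows
because two distinct minimisers could be averaged to a smaller horocycle; existence is the maximum
of c over a compact set of parameters (`exists_minimal_enclosing`). -/

noncomputable section

/-! ### The pencil of conics hyperosculating the circle at a given point -/

open Real in
/-- The value of the quadratic form `-v₀² + v₁² + v₂² + c (v₀ - v₁ cos θ - v₂ sin θ)²`. -/
def horoForm (θ c : ℝ) (v : Fin 3 → ℝ) : ℝ :=
  -v 0 ^ 2 + v 1 ^ 2 + v 2 ^ 2 + c * (v 0 - v 1 * cos θ - v 2 * sin θ) ^ 2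

open Real in
/-- The matrix of `horoForm θ c`. -/
def horoMatrix (θ c : ℝ) : Matrix (Fin 3) (Fin 3) ℝ :=
  !![-1 + c, -c * cos θ, -c * sin θ;
     -c * cos θ, 1 + c * cos θ ^ 2, c * (cos θ * sin θ);
     -c * sin θ, c * (cos θ * sin θ), 1 + c * sin θ ^ 2]

open Real in
/-- The inverse of `horoMatrix θ c`. -/
def horoDualMatrix (θ c : ℝ) : Matrix (Fin 3) (Fin 3) ℝ :=
  !![-1 - c, -c * cos θ, -c * sin θ;
     -c * cos θ, 1 - c * cos θ ^ 2, -c * (cos θ * sin θ);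
     -c * sin θ, -c * (cos θ * sin θ), 1 - c * sin θ ^ 2]

lemma horoMatrix_isSymm (θ c : ℝ) : (horoMatrix θ c).IsSymm := by
  ext i j
  fin_cases i <;> fin_cases j <;> simp [horoMatrix]

/-- The matrix is the rank-one update N + c ℓℓᵗ with N = diag(-1, 1, 1) and ℓ = (1, -cos θ, -sin θ).
Since ℓ is isotropic for N⁻¹, the inverse of the update is again affine in c, without a denominator.
-/
lemma horoMatrix_mul_dual (θ c : ℝ) : horoMatrix θ c * horoDualMatrix θ c = 1 := by
  have h := Real.sin_sq_add_cos_sq θ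
  have hs : Real.sin θ ^ 2 = 1 - Real.cos θ ^ 2 := by linarith
  ext i j
  fin_cases i <;> fin_cases j <;>
    simp [horoMatrix, horoDualMatrix, Matrix.mul_apply, Fin.sum_univ_three] <;>
    ring_nf <;> (try simp only [hs]) <;> grind

lemma horoMatrix_ne_zero (θ c : ℝ) : horoMatrix θ c ≠ 0 := by
  intro h
  have := horoMatrix_mul_dual θ c
  rw [h, zero_mul] at this
  exact zero_ne_one this

lemma dotProduct_horoMatrix (θ c : ℝ) (v : Fin 3 → ℝ) :
    v ⬝ᵥ (horoMatrix θ c).mulVec v = horoForm θ c v := by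
  simp [horoMatrix, horoForm, dotProduct, Matrix.mulVec, Fin.sum_univ_three]
  ring

lemma horoForm_smul (θ c a : ℝ) (v : Fin 3 → ℝ) :
    horoForm θ c (a • v) = a ^ 2 * horoForm θ c v := by
  simp [horoForm]
  ring

/-- The conic with the equation `x² + y² - 1 + c (1 - x cos θ - y sin θ)² = 0`. -/
def horoConic (θ c : ℝ) : Conic :=
  Projectivization.mk ℝ ⟨horoMatrix θ c, horoMatrix_isSymm θ c⟩
    (fun h => horoMatrix_ne_zero θ c (congrArg Subtype.val h))

lemma horoConic_matrix (θ c : ℝ) :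
    ∃ a : ℝ, a ≠ 0 ∧ (horoConic θ c).matrix = a • horoMatrix θ c := by
  obtain ⟨a, ha⟩ := Projectivization.exists_smul_eq_mk_rep ℝ
    (⟨horoMatrix θ c, horoMatrix_isSymm θ c⟩ : symmetricMatrices)
    (fun h => horoMatrix_ne_zero θ c (congrArg Subtype.val h))
  exact ⟨a, a.ne_zero, (congrArg Subtype.val ha).symm⟩

lemma eq_horoConic {C : Conic} {θ c a : ℝ} (h : C.matrix = a • horoMatrix θ c) :
    C = horoConic θ c := by
  have ha : a ≠ 0 := by
    rintro rfl
    exact C.rep_nonzero (Subtype.ext (h.trans (zero_smul ℝ _)))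
  rw [← C.mk_rep]
  refine (Projectivization.mk_eq_mk_iff' ℝ _ _ _ _).2 ⟨a, Subtype.ext h.symm⟩

lemma absoluteConic_eq (θ : ℝ) : absoluteConic = horoConic θ 0 := by
  unfold absoluteConic horoConic
  congr 1
  ext i j
  fin_cases i <;> fin_cases j <;> simp [horoMatrix]

lemma horoConic_form (θ c : ℝ) :
    ∃ a : ℝ, a ≠ 0 ∧ ∀ v, (horoConic θ c).form v = a * horoForm θ c v := by
  obtain ⟨a, ha, h⟩ := horoConic_matrix θ c
  refine ⟨a, ha, fun v => ?_⟩
  rw [Conic.form, h, Matrix.smul_mulVec, dotProduct_smul, dotProduct_horoMatrix, smul_eq_mul]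

lemma horoConic_regular (θ c : ℝ) : (horoConic θ c).IsRegular := by
  obtain ⟨a, ha, h⟩ := horoConic_matrix θ c
  have h1 : (horoMatrix θ c).det * (horoDualMatrix θ c).det = 1 := by
    rw [← Matrix.det_mul, horoMatrix_mul_dual, Matrix.det_one]
  rw [Conic.IsRegular, h, Matrix.det_smul]
  exact mul_ne_zero (pow_ne_zero _ ha) (left_ne_zero_of_mul_eq_one h1)

lemma mem_points_horoConic {θ c : ℝ} {p : ProjPlane} :
    p ∈ (horoConic θ c).points ↔ horoForm θ c p.rep = 0 := by
  obtain ⟨a, ha, h⟩ := horoConic_form θ c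
  simp [Conic.points, h, ha]

lemma isTangent_horoConic {θ c : ℝ} {u : ProjLine} :
    (horoConic θ c).IsTangent u ↔
      -u.rep 0 ^ 2 + u.rep 1 ^ 2 + u.rep 2 ^ 2
        - c * (u.rep 0 + u.rep 1 * Real.cos θ + u.rep 2 * Real.sin θ) ^ 2 = 0 := by
  obtain ⟨a, ha, h⟩ := horoConic_matrix θ c
  have hinv : (horoConic θ c).matrix⁻¹ = a⁻¹ • horoDualMatrix θ c := by
    refine Matrix.inv_eq_right_inv ?_
    rw [h, Matrix.smul_mul, Matrix.mul_smul, horoMatrix_mul_dual, smul_smul, mul_inv_cancel₀ ha,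
      one_smul]
  have hq : u.rep ⬝ᵥ (horoDualMatrix θ c).mulVec u.rep =
      -u.rep 0 ^ 2 + u.rep 1 ^ 2 + u.rep 2 ^ 2
        - c * (u.rep 0 + u.rep 1 * Real.cos θ + u.rep 2 * Real.sin θ) ^ 2 := by
    simp [horoDualMatrix, dotProduct, Matrix.mulVec, Fin.sum_univ_three]
    ring
  rw [Conic.IsTangent, hinv, Matrix.smul_mulVec, dotProduct_smul, hq, smul_eq_mul,
    mul_eq_zero, or_iff_right (inv_ne_zero ha)]

/-! ### Tangents and the sign of the form on the interior -/

lemma eq_zero_of_sq_add_sq_eq_zero {a b : ℝ} (h : a ^ 2 + b ^ 2 = 0) : a = 0 ∧ b = 0 := by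
  constructor
  · exact pow_eq_zero_iff two_ne_zero |>.1 (le_antisymm (by linarith [sq_nonneg b]) (sq_nonneg a))
  · exact pow_eq_zero_iff two_ne_zero |>.1 (le_antisymm (by linarith [sq_nonneg a]) (sq_nonneg b))

lemma eq_zero_of_rotation_eq_zero {C S a b : ℝ} (hcs : S ^ 2 + C ^ 2 = 1)
    (h1 : a * C + b * S = 0) (h2 : -a * S + b * C = 0) : a = 0 ∧ b = 0 :=
  ⟨by linear_combination C * h1 - S * h2 - a * hcs,
    by linear_combination S * h1 + C * h2 - b * hcs⟩

/-- A nonzero vector on which an indefinite form `-w₀² + w₁² + w₂²` is nonnegative has an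
isotropic vector in its annihilator. -/
lemma exists_isotropic_annihilator {w0 w1 w2 : ℝ} (hw : ¬ (w1 = 0 ∧ w2 = 0))
    (h : w0 ^ 2 ≤ w1 ^ 2 + w2 ^ 2) :
    ∃ a0 a1 a2 : ℝ, a0 ≠ 0 ∧ a1 ^ 2 + a2 ^ 2 = a0 ^ 2 ∧ a0 * w0 + a1 * w1 + a2 * w2 = 0 := by
  have hσ2 : √(w1 ^ 2 + w2 ^ 2 - w0 ^ 2) ^ 2 = w1 ^ 2 + w2 ^ 2 - w0 ^ 2 :=
    Real.sq_sqrt (sub_nonneg.2 h)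
  set σ := √(w1 ^ 2 + w2 ^ 2 - w0 ^ 2)
  -- The vector (a1, a2) is w0 (w1, w2) + σ (-w2, w1), whose squared length is (w1² + w2²)(w0² + σ²)
  -- = (w1² + w2²)².
  refine ⟨-(w1 ^ 2 + w2 ^ 2), w1 * w0 - w2 * σ, w2 * w0 + w1 * σ, ?_, ?_, by ring⟩
  · exact fun h0 => hw (eq_zero_of_sq_add_sq_eq_zero (neg_eq_zero.1 h0))
  · linear_combination (w1 ^ 2 + w2 ^ 2) * hσ2

/-- A rotation followed by a parabolic substitution, which subtracts c/2 times the tangent form from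
both axis coordinates, carries every conic of the pencil to the unit circle. Questions about
tangents are thereby reduced to the standard Lorentz form. -/
lemma horoForm_eq (θ c : ℝ) (v : Fin 3 → ℝ) :
    horoForm θ c v =
      (v 1 * Real.cos θ + v 2 * Real.sin θ
        - c / 2 * (v 0 - v 1 * Real.cos θ - v 2 * Real.sin θ)) ^ 2
      + (-v 1 * Real.sin θ + v 2 * Real.cos θ) ^ 2
      - (v 0 - c / 2 * (v 0 - v 1 * Real.cos θ - v 2 * Real.sin θ)) ^ 2 := by
  simp only [horoForm]
  linear_combination (-(v 1 ^ 2) - v 2 ^ 2) * Real.sin_sq_add_cos_sq θ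

lemma exists_tangent_through {θ c : ℝ} {v : Fin 3 → ℝ} (hv : v ≠ 0) (h : 0 ≤ horoForm θ c v) :
    ∃ u : Fin 3 → ℝ, u ≠ 0 ∧ u 0 * v 0 + u 1 * v 1 + u 2 * v 2 = 0 ∧
      -u 0 ^ 2 + u 1 ^ 2 + u 2 ^ 2
        - c * (u 0 + u 1 * Real.cos θ + u 2 * Real.sin θ) ^ 2 = 0 := by
  have hcs := Real.sin_sq_add_cos_sq θ
  rw [horoForm_eq] at h
  generalize Real.cos θ = C at *
  generalize Real.sin θ = S at *
  obtain ⟨a0, a1, a2, ha0, hnorm, hdot⟩ := exists_isotropic_annihilator (w0 := v 0 - c / 2 *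
    (v 0 - v 1 * C - v 2 * S)) (w1 := v 1 * C + v 2 * S - c / 2 * (v 0 - v 1 * C - v 2 * S))
    (w2 := -v 1 * S + v 2 * C) (by
      rintro ⟨h1, h2⟩
      rw [h1, h2] at h
      have h3 : v 0 - c / 2 * (v 0 - v 1 * C - v 2 * S) = 0 :=
        (eq_zero_of_sq_add_sq_eq_zero (b := 0)
          (by nlinarith [sq_nonneg (v 0 - c / 2 * (v 0 - v 1 * C - v 2 * S))])).1
      have hl : v 0 - v 1 * C - v 2 * S = 0 := by linarith
      rw [hl] at h1 h3
      obtain ⟨e1, e2⟩ := eq_zero_of_rotation_eq_zero hcs (by linarith) h2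
      apply hv
      ext i
      fin_cases i <;> simp [e1, e2]
      linarith) (by linarith)
  -- The isotropic covector is pulled back by the transpose of the substitution in `horoForm_eq`.
  set b := c / 2 * (a0 + a1) with hb
  refine ⟨![a0 - b, (a1 + b) * C - a2 * S, (a1 + b) * S + a2 * C], fun h0 => ha0 ?_, ?_, ?_⟩
  · have e0 : a0 - b = 0 := congrFun h0 0
    have e1 : (a1 + b) * C - a2 * S = 0 := congrFun h0 1
    have e2 : (a1 + b) * S + a2 * C = 0 := congrFun h0 2
    have e3 : a1 + b = 0 := by
      linear_combination C * e1 + S * e2 - (a1 + b) * hcs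
    have e4 : a0 + a1 = 0 := by linarith
    have e5 : b = 0 := by rw [hb, e4, mul_zero]
    linarith
  · simp
    linear_combination hdot + hb * (v 1 * C + v 2 * S - v 0)
  · simp
    linear_combination hnorm + (a0 + a1) * 2 * hb + ((a1 + b) ^ 2 + a2 ^ 2
      - c * (a1 + b) * (2 * (a0 - b) + (a1 + b) * (C ^ 2 + S ^ 2 + 1))) * hcs

lemma no_tangent_through {θ c : ℝ} {v q : Fin 3 → ℝ} (h : horoForm θ c v < 0)
    (hi : q 0 * v 0 + q 1 * v 1 + q 2 * v 2 = 0)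
    (ht : -q 0 ^ 2 + q 1 ^ 2 + q 2 ^ 2
        - c * (q 0 + q 1 * Real.cos θ + q 2 * Real.sin θ) ^ 2 = 0) : q = 0 := by
  have hcs := Real.sin_sq_add_cos_sq θ
  rw [horoForm_eq] at h
  generalize Real.cos θ = C at *
  generalize Real.sin θ = S at *
  set T := q 0 + q 1 * C + q 2 * S with hT
  obtain ⟨a0, ha0⟩ : ∃ a0, a0 = q 0 + c / 2 * T := ⟨_, rfl⟩
  obtain ⟨a1, ha1⟩ : ∃ a1, a1 = q 1 * C + q 2 * S - c / 2 * T := ⟨_, rfl⟩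
  obtain ⟨a2, ha2⟩ : ∃ a2, a2 = -q 1 * S + q 2 * C := ⟨_, rfl⟩
  have hnorm : a1 ^ 2 + a2 ^ 2 = a0 ^ 2 := by
    rw [ha0, ha1, ha2]
    linear_combination ht + (q 1 ^ 2 + q 2 ^ 2) * hcs + c * T * hT
  have hdot : a0 * (v 0 - c / 2 * (v 0 - v 1 * C - v 2 * S))
      + a1 * (v 1 * C + v 2 * S - c / 2 * (v 0 - v 1 * C - v 2 * S))
      + a2 * (-v 1 * S + v 2 * C) = 0 := by
    rw [ha0, ha1, ha2, hT]
    linear_combination hi + (q 1 * v 1 + q 2 * v 2) * hcs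
  generalize v 0 - c / 2 * (v 0 - v 1 * C - v 2 * S) = w0 at *
  generalize v 1 * C + v 2 * S - c / 2 * (v 0 - v 1 * C - v 2 * S) = w1 at *
  generalize -v 1 * S + v 2 * C = w2 at *
  have h0 : a0 = 0 := by
    by_contra hne
    have hpos : 0 < a0 ^ 2 := by positivity
    have hlt : a0 ^ 2 * (w1 ^ 2 + w2 ^ 2 - w0 ^ 2) < 0 := mul_neg_of_pos_of_neg hpos h
    -- Lagrange's identity: an isotropic vector orthogonal to w makes the form at w a square divided
    -- by a0², hence nonnegative.
    have : a0 ^ 2 * (w1 ^ 2 + w2 ^ 2 - w0 ^ 2) = (a1 * w2 - a2 * w1) ^ 2 := by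
      linear_combination (-(w1 ^ 2) - w2 ^ 2) * hnorm + (a1 * w1 + a2 * w2 - a0 * w0) * hdot
    linarith [sq_nonneg (a1 * w2 - a2 * w1)]
  obtain ⟨h1, h2⟩ := eq_zero_of_sq_add_sq_eq_zero (hnorm.trans (by rw [h0]; ring))
  have hT0 : T = 0 := by linarith
  rw [hT0] at ha0 ha1
  obtain ⟨e1, e2⟩ := eq_zero_of_rotation_eq_zero hcs (a := q 1) (b := q 2) (by linarith)
    (ha2.symm.trans h2)
  ext i
  fin_cases i <;> simp [e1, e2]
  linarith

lemma mem_interior_horoConic {θ c : ℝ} {p : ProjPlane} :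
    p ∈ (horoConic θ c).interior ↔ horoForm θ c p.rep < 0 := by
  constructor
  · intro h
    by_contra! hn
    obtain ⟨u, hune, hi, ht⟩ := exists_tangent_through p.rep_nonzero hn
    obtain ⟨r, hr⟩ := Projectivization.exists_smul_eq_mk_rep ℝ u hune
    refine h (Projectivization.mk ℝ u hune) ?_ ?_
    · rw [isTangent_horoConic, ← hr]
      simp only [Units.smul_def, Pi.smul_apply, smul_eq_mul]
      linear_combination (r : ℝ) ^ 2 * ht
    · rw [Incident, ← hr]
      simp only [Units.smul_def, dotProduct, Fin.sum_univ_three, Pi.smul_apply, smul_eq_mul]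
      linear_combination (r : ℝ) * hi
  · intro h u ht hi
    rw [isTangent_horoConic] at ht
    rw [Incident, dotProduct, Fin.sum_univ_three] at hi
    exact u.rep_nonzero (no_tangent_through h hi ht)

/-! ### Passage to Cartesian coordinates -/

lemma ofCartesian_rep (p : Plane) : ∃ a : ℝ, a ≠ 0 ∧ (ofCartesian p).rep = a • ![1, p 0, p 1] := by
  obtain ⟨a, ha⟩ := Projectivization.exists_smul_eq_mk_rep ℝ ![1, p 0, p 1]
    (fun h => one_ne_zero (congrFun h 0))
  exact ⟨a, a.ne_zero, ha.symm⟩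

lemma ofCartesian_mem_points {θ c : ℝ} {p : Plane} :
    ofCartesian p ∈ (horoConic θ c).points ↔ horoForm θ c ![1, p 0, p 1] = 0 := by
  obtain ⟨a, ha, h⟩ := ofCartesian_rep p
  rw [mem_points_horoConic, h, horoForm_smul]
  simp [ha]

lemma ofCartesian_mem_interior {θ c : ℝ} {p : Plane} :
    ofCartesian p ∈ (horoConic θ c).interior ↔ horoForm θ c ![1, p 0, p 1] < 0 := by
  obtain ⟨a, ha, h⟩ := ofCartesian_rep p
  rw [mem_interior_horoConic, h, horoForm_smul, mul_neg_iff]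
  have h2 : 0 < a ^ 2 := by positivity
  simp [h2, h2.not_gt]

lemma mem_interior_absoluteConic {p : ProjPlane} :
    p ∈ absoluteConic.interior ↔ p.rep 1 ^ 2 + p.rep 2 ^ 2 < p.rep 0 ^ 2 := by
  rw [absoluteConic_eq 0, mem_interior_horoConic, horoForm]
  constructor <;> intro h <;> linarith

lemma mem_hyperbolicPlane {p : Plane} : p ∈ hyperbolicPlane ↔ p 0 ^ 2 + p 1 ^ 2 < 1 := by
  rw [hyperbolicPlane, Set.mem_ofPred_eq, absoluteConic_eq 0, ofCartesian_mem_interior, horoForm]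
  simp
  constructor <;> intro h <;> linarith

/-! ### Hyperosculation and the classification of horocycles -/

open Real in
/-- The trigonometric polynomial of degree two with the given coefficients. -/
def trigPoly (A B C D E t : ℝ) : ℝ :=
  A + B * cos t + C * sin t + D * cos (2 * t) + E * sin (2 * t)

lemma deriv_trigPoly (A B C D E : ℝ) :
    deriv (trigPoly A B C D E) = trigPoly 0 C (-B) (2 * E) (-2 * D) := by
  funext t
  have h2 : HasDerivAt (fun t : ℝ => 2 * t) 2 t := by simpa using (hasDerivAt_id t).const_mul 2
  have h := ((((hasDerivAt_const t A).add ((Real.hasDerivAt_cos t).const_mul B)).add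
    ((Real.hasDerivAt_sin t).const_mul C)).add (h2.cos.const_mul D)).add (h2.sin.const_mul E)
  refine (HasDerivAt.deriv (f := trigPoly A B C D E) h).trans ?_
  simp only [trigPoly]
  ring

open Real in
/-- A trigonometric polynomial of degree two is determined, up to a scalar, by a fourfold zero. -/
lemma trigPoly_fourfold_zero_iff {A B C D E θ : ℝ} :
    (∀ k < 4, iteratedDeriv k (trigPoly A B C D E) θ = 0) ↔
      ∃ d, A = 3 * d ∧ B = -4 * d * cos θ ∧ C = -4 * d * sin θ ∧
        D = d * cos (2 * θ) ∧ E = d * sin (2 * θ) := by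
  have h0 : iteratedDeriv 0 (trigPoly A B C D E) = trigPoly A B C D E := iteratedDeriv_zero
  have h1 := (iteratedDeriv_succ (n := 0) (f := trigPoly A B C D E)).trans
    ((congrArg deriv h0).trans (deriv_trigPoly ..))
  have h2 := (iteratedDeriv_succ (n := 1) (f := trigPoly A B C D E)).trans
    ((congrArg deriv h1).trans (deriv_trigPoly ..))
  have h3 := (iteratedDeriv_succ (n := 2) (f := trigPoly A B C D E)).trans
    ((congrArg deriv h2).trans (deriv_trigPoly ..))
  have key : (∀ k < 4, iteratedDeriv k (trigPoly A B C D E) θ = 0) ↔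
      trigPoly A B C D E θ = 0 ∧ trigPoly 0 C (-B) (2 * E) (-2 * D) θ = 0 ∧
      trigPoly 0 (-B) (-C) (2 * (-2 * D)) (-2 * (2 * E)) θ = 0 ∧
      trigPoly 0 (-C) (- -B) (2 * (-2 * (2 * E))) (-2 * (2 * (-2 * D))) θ = 0 := by
    rw [← h0, ← h1, ← h2, ← h3, h0]
    constructor
    · intro h
      exact ⟨h0 ▸ h 0 (by norm_num), h 1 (by norm_num), h 2 (by norm_num), h 3 (by norm_num)⟩
    · rintro ⟨e0, e1, e2, e3⟩ k hk
      interval_cases k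
      · rw [h0]; exact e0
      · exact e1
      · exact e2
      · exact e3
  rw [key]
  simp only [trigPoly]
  have hc1 := sin_sq_add_cos_sq θ
  have hc2 := sin_sq_add_cos_sq (2 * θ)
  generalize cos (2 * θ) = c2 at *
  generalize sin (2 * θ) = s2 at *
  generalize cos θ = c1 at *
  generalize sin θ = s1 at *
  constructor
  · rintro ⟨e0, e1, e2, e3⟩
    have f1 : D * s2 - E * c2 = 0 := by linear_combination (e1 + e3) / 6
    have f2 : B * s1 - C * c1 = 0 := by linear_combination (-(4 * e1 + e3) / 3)
    have f3 : B * c1 + C * s1 = -4 * (D * c2 + E * s2) := by linear_combination -e2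
    refine ⟨D * c2 + E * s2, ?_, ?_, ?_, ?_, ?_⟩
    · linear_combination e0 - f3
    · linear_combination (-B) * hc1 + c1 * f3 + s1 * f2
    · linear_combination (-C) * hc1 + s1 * f3 - c1 * f2
    · linear_combination (-D) * hc2 + s2 * f1
    · linear_combination (-E) * hc2 - c2 * f1
  · rintro ⟨d, rfl, rfl, rfl, rfl, rfl⟩
    refine ⟨?_, by ring, ?_, by ring⟩
    · linear_combination (-4 * d) * hc1 + d * hc2
    · linear_combination (4 * d) * hc1 - 4 * d * hc2

lemma form_eq_trigPoly {C : Conic} {M : Matrix (Fin 3) (Fin 3) ℝ} (hM : C.matrix = M)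
    (hs : M.IsSymm) :
    (fun t : ℝ => C.form ![1, Real.cos t, Real.sin t]) =
      trigPoly (M 0 0 + (M 1 1 + M 2 2) / 2) (2 * M 0 1) (2 * M 0 2)
        ((M 1 1 - M 2 2) / 2) (M 1 2) := by
  funext t
  have h10 := hs.apply 0 1
  have h20 := hs.apply 0 2
  have h21 := hs.apply 1 2
  simp [Conic.form, hM, trigPoly, dotProduct, Matrix.mulVec, Fin.sum_univ_three,
    Real.cos_two_mul, Real.sin_two_mul, h10, h20, h21]
  linear_combination M 2 2 * Real.sin_sq_add_cos_sq t

/-- The second intersection of the conic with the diameter through its contact point. It serves as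
the test point that excludes c ≤ 0. -/
lemma horoForm_axis_point (θ c : ℝ) :
    horoForm θ c ![1 + c, (c - 1) * Real.cos θ, (c - 1) * Real.sin θ] = 0 := by
  simp [horoForm]
  have hcs := Real.sin_sq_add_cos_sq θ
  generalize Real.cos θ = C at *
  generalize Real.sin θ = S at *
  linear_combination ((c - 1) ^ 2 + c * (c - 1) ^ 2 * (S ^ 2 + C ^ 2 + 1)
    - 2 * c * (1 + c) * (c - 1)) * hcs

lemma eq_idealPoint_iff {p : ProjPlane} {θ : ℝ} :
    p = idealPoint θ ↔ p.rep 1 = p.rep 0 * Real.cos θ ∧ p.rep 2 = p.rep 0 * Real.sin θ := by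
  constructor
  · rintro rfl
    obtain ⟨a, ha, h⟩ := ofCartesian_rep !₂[Real.cos θ, Real.sin θ]
    rw [idealPoint, h]
    simp
  · rintro ⟨h1, h2⟩
    rw [← p.mk_rep, idealPoint, ofCartesian]
    refine (Projectivization.mk_eq_mk_iff' ℝ _ _ _ _).2 ⟨p.rep 0, ?_⟩
    ext i
    fin_cases i <;> simp [h1, h2]

/-- A fourfold zero leaves only multiples of 3 - 4 cos(t - θ) + cos 2(t - θ) = 2 (1 - cos(t - θ))²,
so the matrix is α N + 2d ℓℓᵗ; regularity gives α ≠ 0 and c = 2d/α. On the conic the absolute form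
equals -c times the square of the tangent form, so the sign of c decides on which side of the circle
its points lie. -/
lemma isHorocycle_iff {H : Conic} : IsHorocycle H ↔ ∃ θ c : ℝ, 0 < c ∧ H = horoConic θ c := by
  constructor
  · rintro ⟨hreg, θ, hosc, hpt⟩
    have hs : H.matrix.IsSymm := H.rep.2
    have hosc' := hosc
    simp only [HyperosculatesAbsoluteAt] at hosc'
    rw [form_eq_trigPoly rfl hs, trigPoly_fourfold_zero_iff] at hosc'
    obtain ⟨d, e1, e2, e3, e4, e5⟩ := hosc'
    have hcs := Real.sin_sq_add_cos_sq θ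
    have hs2 : Real.sin θ ^ 2 = 1 - Real.cos θ ^ 2 := by linarith
    rw [Real.cos_two_mul] at e4
    rw [Real.sin_two_mul] at e5
    obtain ⟨α, hα⟩ : ∃ α, α = H.matrix 1 1 - 2 * d * Real.cos θ ^ 2 := ⟨_, rfl⟩
    have h10 := hs.apply 0 1
    have h20 := hs.apply 0 2
    have h21 := hs.apply 1 2
    have m11 : H.matrix 1 1 = α + 2 * d * Real.cos θ ^ 2 := by linarith
    have m22 : H.matrix 2 2 = α + 2 * d * Real.sin θ ^ 2 := by rw [hs2]; linarith
    have m00 : H.matrix 0 0 = -α + 2 * d := by rw [m22, m11, hs2] at e1; linarith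
    have m01 : H.matrix 0 1 = -2 * d * Real.cos θ := by linarith
    have m02 : H.matrix 0 2 = -2 * d * Real.sin θ := by linarith
    have m12 : H.matrix 1 2 = 2 * d * (Real.cos θ * Real.sin θ) := by linarith
    have hα0 : α ≠ 0 := by
      intro h0
      apply hreg
      rw [Matrix.det_fin_three, h10, h20, h21, m00, m01, m02, m11, m12, m22, h0]
      ring
    have hH : H = horoConic θ (2 * d / α) := by
      refine eq_horoConic (a := α) ?_
      ext i j
      fin_cases i <;> fin_cases j <;>
        simp [horoMatrix, h10, h20, h21, m00, m01, m02, m11, m12, m22] <;> field_simp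
    refine ⟨θ, _, ?_, hH⟩
    by_contra! hc
    generalize 2 * d / α = c at *
    subst hH
    set v : Fin 3 → ℝ := ![1 + c, (c - 1) * Real.cos θ, (c - 1) * Real.sin θ] with hv
    have hvL : v 0 - v 1 * Real.cos θ - v 2 * Real.sin θ = 2 := by
      simp [hv]
      linear_combination (1 - c) * hcs
    have hv0 : v ≠ 0 := by
      intro h0
      rw [h0] at hvL
      simp at hvL
    obtain ⟨r, hr⟩ := Projectivization.exists_smul_eq_mk_rep ℝ v hv0
    have hform : horoForm θ c (Projectivization.mk ℝ v hv0).rep = 0 := by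
      rw [← hr, Units.smul_def, horoForm_smul, horoForm_axis_point, mul_zero]
    have hin := hpt (Projectivization.mk ℝ v hv0) (mem_points_horoConic.2 hform) (by
      rw [Ne, eq_idealPoint_iff, ← hr]
      rintro ⟨g1, g2⟩
      simp only [Units.smul_def, Pi.smul_apply, smul_eq_mul] at g1 g2
      have : (r : ℝ) * 2 = 0 := by
        rw [← hvL]
        linear_combination (-Real.cos θ) * g1 - Real.sin θ * g2 - r * v 0 * hcs
      simp at this)
    rw [mem_interior_absoluteConic] at hin
    rw [horoForm] at hform
    nlinarith [mul_nonneg (neg_nonneg.2 hc) (sq_nonneg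
      ((Projectivization.mk ℝ v hv0).rep 0 - (Projectivization.mk ℝ v hv0).rep 1 * Real.cos θ
        - (Projectivization.mk ℝ v hv0).rep 2 * Real.sin θ))]
  · rintro ⟨θ, c, hc, rfl⟩
    have hcs := Real.sin_sq_add_cos_sq θ
    refine ⟨horoConic_regular θ c, θ, ?_, ?_⟩
    · obtain ⟨a, ha, h⟩ := horoConic_matrix θ c
      have hs : (a • horoMatrix θ c).IsSymm := (horoMatrix_isSymm θ c).smul a
      simp only [HyperosculatesAbsoluteAt]
      rw [form_eq_trigPoly h hs, trigPoly_fourfold_zero_iff]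
      refine ⟨a * c / 2, ?_, ?_, ?_, ?_, ?_⟩ <;>
        simp [horoMatrix, Real.cos_two_mul, Real.sin_two_mul]
      · linear_combination (a * c / 2) * hcs
      · ring
      · ring
      · linear_combination (-(a * c / 2)) * hcs
      · ring
    · intro p hp hne
      rw [mem_points_horoConic, horoForm] at hp
      rw [mem_interior_absoluteConic]
      rw [Ne, eq_idealPoint_iff] at hne
      generalize p.rep = v at *
      by_contra! hle
      -- Outside the open disc both summands of the equation are nonnegative, so both vanish: the
      -- point lies on the circle and on its tangent at the ideal point, hence is that point.
      have hL2 : c * (v 0 - v 1 * Real.cos θ - v 2 * Real.sin θ) ^ 2 = 0 :=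
        le_antisymm (by linarith) (by positivity)
      have hL : v 0 - v 1 * Real.cos θ - v 2 * Real.sin θ = 0 := by
        simpa [hc.ne'] using hL2
      rw [hL] at hp
      have hrot : (-v 1 * Real.sin θ + v 2 * Real.cos θ) ^ 2 = 0 := by
        linear_combination hp + (v 1 ^ 2 + v 2 ^ 2) * hcs
          + (v 0 + v 1 * Real.cos θ + v 2 * Real.sin θ) * hL
      have hrot' := pow_eq_zero_iff two_ne_zero |>.1 hrot
      apply hne
      constructor
      · linear_combination (-v 1) * hcs - Real.cos θ * hL - Real.sin θ * hrot'
      · linear_combination (-v 2) * hcs - Real.sin θ * hL + Real.cos θ * hrot'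

/-! ### Euclidean shape and size -/

/-- The value of `horoForm θ c` in Cartesian coordinates. -/
def horoFun (θ c : ℝ) (p : Plane) : ℝ :=
  p 0 ^ 2 + p 1 ^ 2 - 1 + c * (1 - p 0 * Real.cos θ - p 1 * Real.sin θ) ^ 2

lemma horoForm_cartesian (θ c : ℝ) (p : Plane) :
    horoForm θ c ![1, p 0, p 1] = horoFun θ c p := by
  simp [horoForm, horoFun]
  ring

lemma continuous_horoFun (θ c : ℝ) : Continuous (horoFun θ c) := by
  unfold horoFun
  fun_prop

/-- The Euclidean centre of `horoConic θ c`. -/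
def horoCenter (θ c : ℝ) : Plane := !₂[c / (1 + c) * Real.cos θ, c / (1 + c) * Real.sin θ]

/-- Completing the square. The quadratic part has eigenvalue 1 + c along the axis and 1 across it,
so the semi-axes are 1/(1 + c) and (1 + c)^(-1/2). -/
lemma horoFun_eq {θ c : ℝ} (hc : 0 < c) (p : Plane) :
    horoFun θ c p = (p 0 - horoCenter θ c 0) ^ 2 + (p 1 - horoCenter θ c 1) ^ 2
      + c * ((p 0 - horoCenter θ c 0) * Real.cos θ + (p 1 - horoCenter θ c 1) * Real.sin θ) ^ 2
      - 1 / (1 + c) := by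
  have hc1 : (1 + c) ≠ 0 := by positivity
  obtain ⟨k, hk⟩ : ∃ k, k = c / (1 + c) := ⟨_, rfl⟩
  have hk1 : k * (1 + c) = c := by rw [hk]; field_simp
  have hk2 : 1 / (1 + c) = 1 - k := by rw [hk]; field_simp; ring
  have e0 : horoCenter θ c 0 = k * Real.cos θ := by simp [horoCenter, hk]
  have e1 : horoCenter θ c 1 = k * Real.sin θ := by simp [horoCenter, hk]
  have hcs := Real.sin_sq_add_cos_sq θ
  rw [horoFun, e0, e1, hk2]
  generalize Real.cos θ = C at *
  generalize Real.sin θ = S at *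
  have h : c * ((p 0 - k * C) * C + (p 1 - k * S) * S) ^ 2 = c * (p 0 * C + p 1 * S - k) ^ 2 := by
    have : (p 0 - k * C) * C + (p 1 - k * S) * S = p 0 * C + p 1 * S - k := by
      linear_combination (-k) * hcs
    rw [this]
  rw [h]
  linear_combination (2 * (p 0 * C + p 1 * S) - k - 1) * hk1 - k ^ 2 * hcs

lemma closedInterior_horoConic {θ c : ℝ} (hc : 0 < c) :
    (horoConic θ c).closedInterior = {p | horoFun θ c p ≤ 0} := by
  have hset : {p : Plane | ofCartesian p ∈ (horoConic θ c).interior} =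
      {p | horoFun θ c p < 0} := by
    ext p
    exact ofCartesian_mem_interior.trans (by rw [horoForm_cartesian]; rfl)
  rw [Conic.closedInterior, hset]
  apply Set.Subset.antisymm
  · exact closure_minimal (fun p (hp : horoFun θ c p < 0) => show horoFun θ c p ≤ 0 from hp.le)
      (isClosed_le (continuous_horoFun θ c) continuous_const)
  · intro p (hp : horoFun θ c p ≤ 0)
    have hpos : 0 < 1 / (1 + c) := by positivity
    -- A point of the sublevel set is approached along the segment from the centre, where the
    -- quadratic part scales by t² < 1.
    have hcont : Continuous fun t : ℝ => horoCenter θ c + t • (p - horoCenter θ c) := by fun_prop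
    have htend : Filter.Tendsto (fun t : ℝ => horoCenter θ c + t • (p - horoCenter θ c))
        (nhdsWithin 1 (Set.Ioo 0 1)) (nhds p) := by
      have := (hcont.tendsto 1).mono_left (nhdsWithin_le_nhds (s := Set.Ioo 0 1))
      simpa using this
    have : (nhdsWithin (1 : ℝ) (Set.Ioo 0 1)).NeBot := by
      rw [← mem_closure_iff_nhdsWithin_neBot, closure_Ioo zero_ne_one]
      simp
    refine mem_closure_of_tendsto htend ?_
    filter_upwards [self_mem_nhdsWithin] with t ht
    show horoFun θ c _ < 0
    rw [horoFun_eq hc] at hp ⊢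
    have ht2 : t ^ 2 < 1 := by nlinarith [ht.1, ht.2]
    simp only [PiLp.add_apply, PiLp.smul_apply, PiLp.sub_apply, smul_eq_mul, add_sub_cancel_left]
    generalize p 0 - horoCenter θ c 0 = x at *
    generalize p 1 - horoCenter θ c 1 = y at *
    have hQ : 0 ≤ x ^ 2 + y ^ 2 + c * (x * Real.cos θ + y * Real.sin θ) ^ 2 := by positivity
    have : (t * x) ^ 2 + (t * y) ^ 2 + c * (t * x * Real.cos θ + t * y * Real.sin θ) ^ 2 =
      t ^ 2 * (x ^ 2 + y ^ 2 + c * (x * Real.cos θ + y * Real.sin θ) ^ 2) := by ring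
    rw [this]
    nlinarith [sq_nonneg t]

lemma size_horoConic {θ c : ℝ} (hc : 0 < c) : (horoConic θ c).size = √(1 / (1 + c)) := by
  have hset : {p : Plane | ofCartesian p ∈ (horoConic θ c).points} = {p | horoFun θ c p = 0} := by
    ext p
    exact ofCartesian_mem_points.trans (by rw [horoForm_cartesian]; rfl)
  rw [Conic.size, hset]
  set a := √(1 / (1 + c)) with ha
  have ha2 : a ^ 2 = 1 / (1 + c) := Real.sq_sqrt (by positivity)
  have ha0 : 0 ≤ a := Real.sqrt_nonneg _
  have hsub : {p | horoFun θ c p = 0} ⊆ Metric.closedBall (horoCenter θ c) a := by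
    intro p (hp : horoFun θ c p = 0)
    rw [horoFun_eq hc] at hp
    rw [Metric.mem_closedBall, EuclideanSpace.dist_eq, Fin.sum_univ_two, Real.dist_eq,
      Real.dist_eq, sq_abs, sq_abs]
    refine Real.sqrt_le_sqrt ?_
    have : 0 ≤ c * ((p 0 - horoCenter θ c 0) * Real.cos θ
      + (p 1 - horoCenter θ c 1) * Real.sin θ) ^ 2 := by positivity
    linarith
  have hle := (Metric.diam_mono hsub Metric.isBounded_closedBall).trans
    (Metric.diam_closedBall ha0)
  have hcs := Real.sin_sq_add_cos_sq θ
  -- The points centre ± w are the ends of the major axis; their distance 2a attains the upper bound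
  -- given by the enclosing disc.
  set w : Plane := !₂[-(a * Real.sin θ), a * Real.cos θ] with hw
  have hw0 : w 0 = -(a * Real.sin θ) := rfl
  have hw1 : w 1 = a * Real.cos θ := rfl
  have hmem1 : horoCenter θ c + w ∈ {p | horoFun θ c p = 0} := by
    rw [Set.mem_ofPred_eq, horoFun_eq hc, ← ha2]
    simp only [PiLp.add_apply, add_sub_cancel_left, hw0, hw1]
    linear_combination a ^ 2 * hcs
  have hmem2 : horoCenter θ c - w ∈ {p | horoFun θ c p = 0} := by
    rw [Set.mem_ofPred_eq, horoFun_eq hc, ← ha2]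
    simp only [PiLp.sub_apply, sub_sub_cancel_left, hw0, hw1]
    linear_combination a ^ 2 * hcs
  have hdist := Metric.dist_le_diam_of_mem (Metric.isBounded_closedBall.subset hsub) hmem1 hmem2
  have hd : dist (horoCenter θ c + w) (horoCenter θ c - w) = 2 * a := by
    rw [EuclideanSpace.dist_eq, Fin.sum_univ_two, Real.dist_eq, Real.dist_eq, sq_abs, sq_abs]
    simp only [PiLp.add_apply, PiLp.sub_apply, hw0, hw1]
    rw [← Real.sqrt_sq (by positivity : 0 ≤ 2 * a)]
    congr 1
    linear_combination 4 * a ^ 2 * hcs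
  rw [hd] at hdist
  linarith

lemma size_horoConic_le {θ θ' c c' : ℝ} (hc : 0 < c) (hc' : 0 < c') :
    (horoConic θ c).size ≤ (horoConic θ' c').size ↔ c' ≤ c := by
  rw [size_horoConic hc, size_horoConic hc', Real.sqrt_le_sqrt_iff (by positivity),
    one_div_le_one_div (by positivity) (by positivity)]
  constructor <;> intro h <;> linarith

lemma size_horoConic_lt_iff {θ c : ℝ} (hc : 0 < c) :
    (horoConic θ c).size < (2 : ℝ) ^ (-(1 / 2) : ℝ) ↔ 1 < c := by
  have : (2 : ℝ) ^ (-(1 / 2) : ℝ) = √(1 / (1 + 1)) := by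
    rw [Real.rpow_neg (by norm_num), ← Real.sqrt_eq_rpow, one_div, Real.sqrt_inv]
    norm_num
  rw [this, size_horoConic hc, Real.sqrt_lt_sqrt_iff (by positivity),
    one_div_lt_one_div (by positivity) (by positivity)]
  constructor <;> intro h <;> linarith

/-! ### Averaging two horocycles of equal size -/

lemma horoConic_congr {θ θ' c : ℝ} (h1 : Real.cos θ = Real.cos θ')
    (h2 : Real.sin θ = Real.sin θ') : horoConic θ c = horoConic θ' c := by
  obtain ⟨a, -, h⟩ := horoConic_matrix θ c
  exact eq_horoConic (a := a) (h.trans (by simp only [horoMatrix, h1, h2]))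

lemma horoFun_le_zero_iff {θ c : ℝ} {p : Plane} (hc : 0 < c) (hp : p 0 ^ 2 + p 1 ^ 2 < 1) :
    horoFun θ c p ≤ 0 ↔ 1 - p 0 * Real.cos θ - p 1 * Real.sin θ
      ≤ √(1 / c) * √(1 - (p 0 ^ 2 + p 1 ^ 2)) := by
  have hL : 0 ≤ 1 - p 0 * Real.cos θ - p 1 * Real.sin θ := by
    nlinarith [sq_nonneg (p 0 - Real.cos θ), sq_nonneg (p 1 - Real.sin θ),
      Real.sin_sq_add_cos_sq θ]
  rw [← Real.sqrt_mul (by positivity), Real.le_sqrt hL (by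
    have : 0 ≤ 1 - (p 0 ^ 2 + p 1 ^ 2) := by linarith
    positivity), one_div, inv_mul_eq_div, le_div_iff₀ hc, horoFun]
  constructor <;> intro h <;> linarith

/-- Two different horocycles of equal size `< 2^(-1/2)` with a common point can be replaced by a
smaller one that contains everything they have in common. -/
lemma exists_smaller_horocycle {θ₀ θ₁ c : ℝ} (hc : 1 < c)
    (hne : horoConic θ₀ c ≠ horoConic θ₁ c)
    (hcom : ∃ p : Plane, p 0 ^ 2 + p 1 ^ 2 < 1 ∧ horoFun θ₀ c p ≤ 0 ∧ horoFun θ₁ c p ≤ 0) :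
    ∃ θ c', c < c' ∧ ∀ p : Plane, p 0 ^ 2 + p 1 ^ 2 < 1 → horoFun θ₀ c p ≤ 0 →
      horoFun θ₁ c p ≤ 0 → horoFun θ c' p ≤ 0 := by
  have hc0 : 0 < c := by linarith
  have hk0 : 0 < √(1 / c) := by positivity
  have hk1 : √(1 / c) < 1 := by
    rw [Real.sqrt_lt' one_pos, one_pow, div_lt_one hc0]
    exact hc
  -- Polar form of the midpoint of the two directions.
  obtain ⟨m, θ, hm0, hmx, hmy⟩ : ∃ m θ : ℝ, 0 ≤ m ∧
      m * Real.cos θ = (Real.cos θ₀ + Real.cos θ₁) / 2 ∧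
      m * Real.sin θ = (Real.sin θ₀ + Real.sin θ₁) / 2 :=
    ⟨_, _, norm_nonneg _, Complex.norm_mul_cos_arg ⟨(Real.cos θ₀ + Real.cos θ₁) / 2,
      (Real.sin θ₀ + Real.sin θ₁) / 2⟩, Complex.norm_mul_sin_arg _⟩
  have hmid : ∀ p : Plane, p 0 ^ 2 + p 1 ^ 2 < 1 → horoFun θ₀ c p ≤ 0 → horoFun θ₁ c p ≤ 0 →
      1 - m * (p 0 * Real.cos θ + p 1 * Real.sin θ) ≤
        √(1 / c) * √(1 - (p 0 ^ 2 + p 1 ^ 2)) := by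
    intro p hp h0 h1
    rw [horoFun_le_zero_iff hc0 hp] at h0 h1
    linear_combination (h0 + h1) / 2 + (-p 0) * hmx - p 1 * hmy
  have hs1 : ∀ p : Plane, √(1 - (p 0 ^ 2 + p 1 ^ 2)) ≤ 1 := fun p =>
    Real.sqrt_le_one.2 (by nlinarith [sq_nonneg (p 0), sq_nonneg (p 1)])
  have hmpos : 0 < m := by
    -- Antipodal directions would give 1 ≤ k √(1 - |p|²) ≤ k < 1 at a common point.
    refine lt_of_le_of_ne hm0 fun h0 => ?_
    obtain ⟨p, hp, h1, h2⟩ := hcom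
    have := hmid p hp h1 h2
    rw [← h0] at this
    nlinarith [hs1 p]
  have hm1 : m < 1 := by
    have c0 := Real.sin_sq_add_cos_sq θ₀
    have c1 := Real.sin_sq_add_cos_sq θ₁
    have hm2 : m ^ 2 =
        1 - ((Real.cos θ₀ - Real.cos θ₁) ^ 2 + (Real.sin θ₀ - Real.sin θ₁) ^ 2) / 4 := by
      have : m ^ 2 = (m * Real.cos θ) ^ 2 + (m * Real.sin θ) ^ 2 := by
        linear_combination (-m ^ 2) * Real.sin_sq_add_cos_sq θ
      rw [this, hmx, hmy]
      linear_combination (c0 + c1) / 2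
    by_contra! hge
    have : (Real.cos θ₀ - Real.cos θ₁) ^ 2 + (Real.sin θ₀ - Real.sin θ₁) ^ 2 = 0 :=
      le_antisymm (by nlinarith) (by positivity)
    obtain ⟨g1, g2⟩ := eq_zero_of_sq_add_sq_eq_zero this
    exact hne (horoConic_congr (sub_eq_zero.1 g1) (sub_eq_zero.1 g2))
  obtain ⟨k, hkdef⟩ : ∃ k, k = √(1 / c) := ⟨_, rfl⟩
  rw [← hkdef] at hk0 hk1 hmid
  have hk2 : k ^ 2 = 1 / c := by rw [hkdef, Real.sq_sqrt (by positivity)]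
  -- The threshold 1 - (1 - k)/m is what the bound needs at |p| = 0, the worst case; it lies below k
  -- because m < 1 and k < 1.
  obtain ⟨k', hk'0, hk'k, hk'm⟩ : ∃ k', 0 < k' ∧ k' < k ∧ 1 - (1 - k) / m ≤ k' := by
    have : 1 - (1 - k) / m < k := by
      have : 1 - k < (1 - k) / m := by rw [lt_div_iff₀ hmpos]; nlinarith
      linarith
    obtain ⟨k', h1, h2⟩ := exists_between (max_lt hk0 this)
    exact ⟨k', (le_max_left _ _).trans_lt h1, h2, (le_max_right _ _).trans h1.le⟩
  refine ⟨θ, 1 / k' ^ 2, ?_, fun p hp h0 h1 => ?_⟩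
  · rw [lt_one_div hc0 (by positivity), ← hk2]
    gcongr
  · rw [horoFun_le_zero_iff (by positivity) hp, one_div_one_div, Real.sqrt_sq hk'0.le]
    have h := hmid p hp h0 h1
    have hs := hs1 p
    generalize √(1 - (p 0 ^ 2 + p 1 ^ 2)) = s at *
    have hkm : m * (1 - k') ≤ 1 - k := by
      have : (1 - k) / m ≥ 1 - k' := by linarith
      rw [ge_iff_le, le_div_iff₀ hmpos] at this
      linarith
    -- The left side is at most m - 1 + (k - m k') s. As k - m k' ≥ 0 and s ≤ 1, this is at most m -
    -- 1 + k - m k' ≤ 0.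
    have : m * (1 - p 0 * Real.cos θ - p 1 * Real.sin θ - k' * s) ≤ 0 := by
      have e1 : 0 ≤ (k - m * k') * (1 - s) :=
        mul_nonneg (by nlinarith) (by linarith)
      linarith [e1]
    have := nonpos_of_mul_nonpos_right this hmpos
    linarith

/-! ### Existence of a minimal enclosing horocycle -/

/-- The difference of the two sides is |p - u|²/2. -/
lemma one_sub_dotProduct_ge (θ : ℝ) (p : Plane) :
    (1 - (p 0 ^ 2 + p 1 ^ 2)) / 2 ≤ 1 - p 0 * Real.cos θ - p 1 * Real.sin θ := by
  linarith [sq_nonneg (p 0 - Real.cos θ), sq_nonneg (p 1 - Real.sin θ),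
    Real.sin_sq_add_cos_sq θ]

lemma encloses_horoConic {θ c : ℝ} (hc : 0 < c) {F : Set Plane} :
    (horoConic θ c).Encloses F ↔ ∀ p ∈ F, horoFun θ c p ≤ 0 := by
  rw [Conic.Encloses, closedInterior_horoConic hc]
  rfl

/-- A single enclosed point bounds c from above, which confines the parameters to a compact set. -/
lemma le_of_horoFun_le_zero {θ c : ℝ} {p : Plane} (hp : p 0 ^ 2 + p 1 ^ 2 < 1)
    (h : horoFun θ c p ≤ 0) : c ≤ 4 / (1 - (p 0 ^ 2 + p 1 ^ 2)) := by
  have hL := one_sub_dotProduct_ge θ p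
  rw [horoFun] at h
  obtain ⟨s, hs⟩ : ∃ s, s = 1 - (p 0 ^ 2 + p 1 ^ 2) := ⟨_, rfl⟩
  have hs0 : 0 < s := by linarith
  rw [← hs] at hL ⊢
  rw [le_div_iff₀ hs0]
  rcases le_or_gt c 0 with hc | hc
  · nlinarith
  · have h1 : (s / 2) ^ 2 ≤ (1 - p 0 * Real.cos θ - p 1 * Real.sin θ) ^ 2 := by gcongr
    have h2 := mul_le_mul_of_nonneg_left h1 hc.le
    have h3 : s * (c * s) ≤ s * 4 := by nlinarith
    exact le_of_mul_le_mul_left h3 hs0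

/-- Minimal size is maximal c. With θ reduced modulo 2π and c between c₁ and the bound from one
point of F, the admissible pairs form a compact set on which c attains its maximum. -/
lemma exists_minimal_enclosing {F : Set Plane} (hne : F.Nonempty) (hF : F ⊆ hyperbolicPlane)
    {θ₁ c₁ : ℝ} (h₁ : ∀ p ∈ F, horoFun θ₁ c₁ p ≤ 0) :
    ∃ θ c : ℝ, c₁ ≤ c ∧ (∀ p ∈ F, horoFun θ c p ≤ 0) ∧
      ∀ θ' c' : ℝ, (∀ p ∈ F, horoFun θ' c' p ≤ 0) → c' ≤ c := by
  obtain ⟨p, hpF⟩ := hne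
  have hp := mem_hyperbolicPlane.1 (hF hpF)
  set K : Set (ℝ × ℝ) := (Set.Icc 0 (2 * Real.pi) ×ˢ Set.Icc c₁ (4 / (1 - (p 0 ^ 2 + p 1 ^ 2)))) ∩
    ⋂ q ∈ F, {x | horoFun x.1 x.2 q ≤ 0} with hK
  have hcomp : IsCompact K := by
    refine (isCompact_Icc.prod isCompact_Icc).inter_right
      (isClosed_biInter fun q _ => isClosed_le ?_ continuous_const)
    unfold horoFun
    fun_prop
  have hmem : ∀ θ c, c₁ ≤ c → (∀ q ∈ F, horoFun θ c q ≤ 0) → ∃ θ', (θ', c) ∈ K := by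
    intro θ c hc h
    refine ⟨toIcoMod Real.two_pi_pos 0 θ, ⟨⟨?_, hc, le_of_horoFun_le_zero hp (h p hpF)⟩, ?_⟩⟩
    · have := toIcoMod_mem_Ico Real.two_pi_pos 0 θ
      rw [zero_add] at this
      exact Set.Ico_subset_Icc_self this
    · refine Set.mem_iInter₂.2 fun q hq => ?_
      show horoFun (toIcoMod Real.two_pi_pos 0 θ) c q ≤ 0
      have := h q hq
      rwa [horoFun, ← self_sub_toIcoDiv_zsmul Real.two_pi_pos 0 θ, zsmul_eq_mul,
        Real.cos_sub_int_mul_two_pi, Real.sin_sub_int_mul_two_pi]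
  obtain ⟨θ₂, hθ₂⟩ := hmem θ₁ c₁ le_rfl h₁
  obtain ⟨⟨θ, c⟩, hx, hmax⟩ := hcomp.exists_isMaxOn ⟨_, hθ₂⟩ continuous_snd.continuousOn
  refine ⟨θ, c, hx.1.2.1, fun q hq => Set.mem_iInter₂.1 hx.2 q hq, fun θ' c' h' => ?_⟩
  rcases le_or_gt c' c₁ with hle | hlt
  · exact hle.trans hx.1.2.1
  · obtain ⟨θ'', hθ''⟩ := hmem θ' c' hlt.le h'
    exact hmax hθ''

/-! ### Assembly of the two statements -/

lemma exists_ofCartesian_of_mem_interior {θ c : ℝ} (hc : 0 ≤ c) {p : ProjPlane}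
    (hp : p ∈ (horoConic θ c).interior) :
    ∃ q : Plane, ofCartesian q = p ∧ q 0 ^ 2 + q 1 ^ 2 < 1 := by
  have h := mem_interior_horoConic.1 hp
  rw [horoForm] at h
  have hlt : p.rep 1 ^ 2 + p.rep 2 ^ 2 < p.rep 0 ^ 2 := by
    have : 0 ≤ c * (p.rep 0 - p.rep 1 * Real.cos θ - p.rep 2 * Real.sin θ) ^ 2 := by positivity
    linarith
  have h0 : p.rep 0 ≠ 0 := by
    intro h0
    rw [h0] at hlt
    nlinarith [sq_nonneg (p.rep 1), sq_nonneg (p.rep 2)]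
  have hq : ofCartesian !₂[p.rep 1 / p.rep 0, p.rep 2 / p.rep 0] = p := by
    rw [← p.mk_rep, ofCartesian]
    refine (Projectivization.mk_eq_mk_iff' ℝ _ _ _ _).2 ⟨(p.rep 0)⁻¹, ?_⟩
    ext i
    fin_cases i <;> simp [h0, div_eq_inv_mul]
  refine ⟨_, hq, ?_⟩
  have := mem_interior_absoluteConic.2 hlt
  rw [← hq] at this
  exact mem_hyperbolicPlane.1 this

theorem mainTheorem3 :
    (∀ F : Set Plane, F.Nonempty → IsCompact F → F ⊆ hyperbolicPlane →
      (∃ H : Conic, IsHorocycle H ∧ H.size < (2 : ℝ) ^ (-(1 / 2) : ℝ) ∧ H.Encloses F) →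
      ∃! H : Conic, IsMinimalEnclosingHorocycle F H) ∧
    (∀ H₀ H₁ : Conic, IsHorocycle H₀ → IsHorocycle H₁ → H₀ ≠ H₁ →
      H₀.size = H₁.size → H₀.size < (2 : ℝ) ^ (-(1 / 2) : ℝ) →
      (H₀.interior ∩ H₁.interior).Nonempty →
      ∃ H : Conic, IsHorocycle H ∧ H.size < H₀.size ∧
        H₀.interior ∩ H₁.interior ⊆ H.interior) := by
  constructor
  · rintro F hne - hF ⟨H₁, hH₁, hsize, henc⟩
    obtain ⟨θ₁, c₁, hc₁, rfl⟩ := isHorocycle_iff.1 hH₁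
    rw [size_horoConic_lt_iff hc₁] at hsize
    rw [encloses_horoConic hc₁] at henc
    obtain ⟨θ, c, hc, hencl, hmax⟩ := exists_minimal_enclosing hne hF henc
    have hc0 : 0 < c := hc₁.trans_le hc
    refine ⟨horoConic θ c, ⟨isHorocycle_iff.2 ⟨θ, c, hc0, rfl⟩,
      (encloses_horoConic hc0).2 hencl, ?_⟩, ?_⟩
    · intro H' hH' henc'
      obtain ⟨θ', c', hc', rfl⟩ := isHorocycle_iff.1 hH'
      exact (size_horoConic_le hc0 hc').2 (hmax θ' c' ((encloses_horoConic hc').1 henc'))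
    · rintro H ⟨hH, hHenc, hHmin⟩
      obtain ⟨θ', c', hc', rfl⟩ := isHorocycle_iff.1 hH
      have hle := (size_horoConic_le hc' hc0).1
        (hHmin _ (isHorocycle_iff.2 ⟨θ, c, hc0, rfl⟩) ((encloses_horoConic hc0).2 hencl))
      rw [encloses_horoConic hc'] at hHenc
      obtain rfl : c' = c := le_antisymm (hmax θ' c' hHenc) hle
      by_contra hdiff
      obtain ⟨p, hp⟩ := hne
      obtain ⟨θ₂, c₂, hlt, h₂⟩ := exists_smaller_horocycle (hsize.trans_le hc) hdiff
        ⟨p, mem_hyperbolicPlane.1 (hF hp), hHenc p hp, hencl p hp⟩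
      exact hlt.not_ge (hmax θ₂ c₂ fun q hq =>
        h₂ q (mem_hyperbolicPlane.1 (hF hq)) (hHenc q hq) (hencl q hq))
  · rintro H₀ H₁ hH₀ hH₁ hdiff hsize hlt ⟨p, hp₀, hp₁⟩
    obtain ⟨θ₀, c, hc, rfl⟩ := isHorocycle_iff.1 hH₀
    obtain ⟨θ₁, c', hc', rfl⟩ := isHorocycle_iff.1 hH₁
    obtain rfl : c = c' := le_antisymm ((size_horoConic_le hc' hc).1 hsize.ge)
      ((size_horoConic_le hc hc').1 hsize.le)
    rw [size_horoConic_lt_iff hc] at hlt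
    obtain ⟨q, rfl, hq⟩ := exists_ofCartesian_of_mem_interior hc.le hp₀
    rw [ofCartesian_mem_interior, horoForm_cartesian] at hp₀ hp₁
    obtain ⟨θ, c₂, hlt₂, h₂⟩ := exists_smaller_horocycle hlt hdiff ⟨q, hq, hp₀.le, hp₁.le⟩
    -- Averaging yields only a weak inequality for c₂. Decreasing c₂ to c₃ > c makes it strict,
    -- since 1 - ⟨p,u⟩ > 0 in the open disc.
    obtain ⟨c₃, hc₃, hc₃₂⟩ := exists_between hlt₂
    have hc₃0 : 0 < c₃ := hc.trans hc₃
    refine ⟨horoConic θ c₃, isHorocycle_iff.2 ⟨θ, c₃, hc₃0, rfl⟩, ?_, ?_⟩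
    · exact lt_of_not_ge fun h => hc₃.not_ge ((size_horoConic_le hc hc₃0).1 h)
    · rintro x ⟨hx₀, hx₁⟩
      obtain ⟨y, rfl, hy⟩ := exists_ofCartesian_of_mem_interior hc.le hx₀
      rw [ofCartesian_mem_interior, horoForm_cartesian] at hx₀ hx₁ ⊢
      have h := h₂ y hy hx₀.le hx₁.le
      have hL : 0 < 1 - y 0 * Real.cos θ - y 1 * Real.sin θ :=
        lt_of_lt_of_le (by linarith) (one_sub_dotProduct_ge θ y)
      rw [horoFun] at h ⊢
      have := mul_lt_mul_of_pos_right hc₃₂ (pow_pos hL 2)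
      linarith

end
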